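/- Let $\kappa, N, k\ge 0$ and $1\le T\le 2^{\kappa}$ be integers, let $X=\{0,1\}^{\kappa}$, let $Y$ be a finite set, let $x_0\in X$, and put $p := T/2^{\kappa}$. Let $h_0,\dots,h_{N-1} : X\times Y\to X$ be independent, uniformly random functions, available through quantum queries $|i,x,y,r\rangle\mapsto|i,x,y,r\oplus h_i(x,y)\rangle$. A sequence $(y_0,\dots,y_{\ell-1})\in Y^{\ell}$ with $\ell\le N$ is a Chain-of-PoWs solution of length $\ell$ if the values defined by $x_{i+1}:=h_i(x_i,y_i)$, $0\le i<\ell$, all lie in the target set consisting of the $T$ elements of $X$ whose binary value is less than $T$ (so a single classical query hits the target with probability $p$). Consider any quantum query adversary $\mathcal A$ with a finite-dimensional workspace: it applies arbitrary oracle-independent unitaries to its registers, makes at most $N$ queries in total between them, and finally measures its registers in the computational basis and outputs a sequence determined by the result. Then the probability, over the choice of the $h_i$ and the measurement, that $\mathcal A$ outputs a Chain-of-PoWs solution of length at least $k$ is at most \[ \exp\!\left(-2k\,\ln\!\left(\frac{k}{e\,(N+k)}\cdot\frac{1}{\sqrt p}\right)\right), \] where for $k=0$ this bound is read as $1$. 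-/

import Mathlib

namespace ChainOfPoWs

noncomputable section

/-- The family of oracles `h_0, …, h_{N-1}`, each `h_i : X × Y → X` with `X = {0,1}^κ`. -/
abbrev Oracles (N κ : ℕ) (Y : Type*) := Fin N → BitVec κ × Y → BitVec κ

/-- Computational basis of the adversary's registers: the index `i` of the queried oracle,
the input `(x, y)`, the response register `r`, and the workspace content `w`. -/
abbrev Register (N κ : ℕ) (Y W : Type*) := (Fin N × BitVec κ × Y) × BitVec κ × W

/-- Pure (not necessarily normalised) states of the adversary. -/
abbrev State (N κ : ℕ) (Y W : Type*) [Fintype Y] [Fintype W] :=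
  EuclideanSpace ℂ (Register N κ Y W)

/-- The permutation `|i, x, y, r, w⟩ ↦ |i, x, y, r ⊕ h_i(x, y), w⟩` of the basis states. -/
def queryPerm {N κ : ℕ} {Y : Type*} (W : Type*) (h : Oracles N κ Y) :
    Equiv.Perm (Register N κ Y W) :=
  Function.Involutive.toPerm
    (fun b => (b.1, b.2.1 ^^^ h b.1.1 b.1.2, b.2.2))
    (fun b => by simp)

/-- The unitary black box for the oracles: the linear extension of `queryPerm`. -/
def queryUnitary {N κ : ℕ} {Y : Type*} [Fintype Y] (W : Type*) [Fintype W]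
    (h : Oracles N κ Y) : State N κ Y W ≃ₗᵢ[ℂ] State N κ Y W :=
  LinearIsometryEquiv.piLpCongrLeft 2 ℂ ℂ (queryPerm W h)

/-- A quantum query adversary with finite-dimensional workspace: a normalised initial state,
the number of queries, the oracle-independent unitaries applied before, between and after the
queries (only those with index at most `queries` are used), and the sequence of elements of `Y`
that is output when the final computational-basis measurement yields a given basis state. -/
structure Adversary (N κ : ℕ) (Y W : Type*) [Fintype Y] [Fintype W] where
  queries : ℕ
  init : State N κ Y W
  norm_init : ‖init‖ = 1
  unitary : ℕ → (State N κ Y W ≃ₗᵢ[ℂ] State N κ Y W)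
  output : Register N κ Y W → List Y

namespace Adversary

variable {N κ : ℕ} {Y W : Type*} [Fintype Y] [Fintype W]

/-- The state right before query number `t + 1`. -/
def stateAfter (A : Adversary N κ Y W) (h : Oracles N κ Y) : ℕ → State N κ Y W
  | 0 => A.unitary 0 A.init
  | t + 1 => A.unitary (t + 1) (queryUnitary W h (A.stateAfter h t))

/-- The state that is measured at the end. -/
def finalState (A : Adversary N κ Y W) (h : Oracles N κ Y) : State N κ Y W :=
  A.stateAfter h A.queries

end Adversary

/-- `IsChainFrom h T i x [y_i, y_{i+1}, …]`: with `x_i = x` and `x_{j+1} = h_j(x_j, y_j)`, all the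
values `x_{i+1}, x_{i+2}, …` belong to the target set, the `T` elements of `{0,1}^κ` whose binary
value is less than `T`. (There must be an oracle for every step, so the indices stay below `N`.) -/
def IsChainFrom {N κ : ℕ} {Y : Type*} (h : Oracles N κ Y) (T : ℕ) :
    ℕ → BitVec κ → List Y → Prop
  | _, _, [] => True
  | i, x, y :: ys => ∃ hi : i < N,
      (h ⟨i, hi⟩ (x, y)).toNat < T ∧ IsChainFrom h T (i + 1) (h ⟨i, hi⟩ (x, y)) ys

/-- `ys` is a Chain-of-PoWs solution of size at least `k` for the start value `x₀`. -/
def IsSolution {N κ : ℕ} {Y : Type*} (h : Oracles N κ Y) (T : ℕ) (x₀ : BitVec κ) (k : ℕ)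
    (ys : List Y) : Prop :=
  k ≤ ys.length ∧ IsChainFrom h T 0 x₀ ys

open Classical in
/-- Success probability for fixed oracles: the Born probability of measuring a basis state whose
associated output is a solution of size at least `k`. -/
def successProbGiven {N κ : ℕ} {Y W : Type*} [Fintype Y] [Fintype W] (A : Adversary N κ Y W)
    (T : ℕ) (x₀ : BitVec κ) (k : ℕ) (h : Oracles N κ Y) : ℝ :=
  ∑ b : Register N κ Y W, if IsSolution h T x₀ k (A.output b) then ‖A.finalState h b‖ ^ 2 else 0

open Classical in
/-- Success probability over independent uniformly random oracles `h_0, …, h_{N-1}`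
(that is, over a uniformly random element of the finite set of oracle families). -/
def successProb {N κ : ℕ} {Y W : Type*} [Fintype Y] [Fintype W] (A : Adversary N κ Y W)
    (T : ℕ) (x₀ : BitVec κ) (k : ℕ) : ℝ :=
  (∑ h : Oracles N κ Y, successProbGiven A T x₀ k h) / (Fintype.card (Oracles N κ Y) : ℝ)

end

end ChainOfPoWs

namespace ChainOfPoWs

noncomputable section

/-! ### Geometry of two projections with `J * P * J = p • J` -/

section ProjectionPair

variable {E : Type*} [NormedAddCommGroup E] [InnerProductSpace ℂ E]

/-! The oracle is purified: it is held in uniform superposition, and each cell `c` (an oracle index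
with an input) carries two projections, `average c` (value still uniform, hence nothing learned) and
`hit T c` (value in the target). From them comes `known T c`, which annihilates states that are
uniform at `c` and lies within `√p` of `hit T c` in operator norm (`norm_complProj_sub_le`).

The potential is the norm of `progress T l univ` applied to the joint state; this operator is the
product over all cells of `weight`, which is `l` on the range of `known` and `1` on its kernel.
Initially it acts trivially. A query, restricted to one queried cell, commutes with all other
factors. It commutes exactly with `hit`, hence up to `2√p` with `known`, so the potential grows by
at most `exp (l√p)` (`norm_progress_jointQuery_le`).

At the end each link of a claimed chain uses up the factor of one cell and costs `p + 1/l²` in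
squared norm (`norm_sq_le_weight`, `norm_event_isChainFrom_sq_le`). Thus the success probability
with `q` queries is at most `(p + 1/l²)^k * exp (2ql√p)`, and `l = k/(N√p)` gives the claim. -/

theorem norm_sq_eq_of_isSymmetric_of_idem {R : Module.End ℂ E} (hs : R.IsSymmetric)
    (hi : R * R = R) (x : E) : ‖x‖ ^ 2 = ‖x - R x‖ ^ 2 + ‖R x‖ ^ 2 := by
  have hRR : R (R x) = R x := congrArg (fun f : Module.End ℂ E => f x) hi
  have h : inner ℂ (x - R x) (R x) = 0 := by
    rw [← hs, map_sub, hRR, sub_self, inner_zero_left]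
  have := norm_add_sq_eq_norm_sq_add_norm_sq_of_inner_eq_zero (𝕜 := ℂ) (x - R x) (R x) h
  simpa [sq] using this

theorem norm_apply_le_of_isSymmetric_of_idem {R : Module.End ℂ E} (hs : R.IsSymmetric)
    (hi : R * R = R) (x : E) : ‖R x‖ ≤ ‖x‖ := by
  have := norm_sq_eq_of_isSymmetric_of_idem hs hi x
  exact le_of_sq_le_sq (by nlinarith [sq_nonneg ‖x - R x‖]) (norm_nonneg _)

/-- For projections `J`, `P` with `J P J = p J`: the projection onto the closure of
`(1 - J) (range P)`. -/
def complProj (J P : Module.End ℂ E) (p : ℝ) : Module.End ℂ E :=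
  P - J + ((1 - p : ℝ) : ℂ)⁻¹ • ((1 - P) * J * (1 - P))

variable {J P : Module.End ℂ E} {p : ℝ}

theorem mul_compl_mul (hJ : J * J = J) (hJPJ : J * P * J = (p : ℂ) • J) :
    J * (1 - P) * J = ((1 - p : ℝ) : ℂ) • J := by
  rw [mul_sub, sub_mul, mul_one, hJ, hJPJ]
  push_cast
  rw [sub_smul, one_smul]

/-- With `Q = 1 - P` and `q = 1 - p`, the relation `J Q J = q J` makes `q⁻¹ Q J Q` the projection
onto `Q (range J)`. Adding `P` gives the projection onto `range P + range J`, and subtracting `J`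
removes `range J` from it. -/
theorem complProj_mul_self (hJ : J * J = J) (hP : P * P = P) (hJPJ : J * P * J = (p : ℂ) • J)
    (hp : p < 1) : complProj J P p * complProj J P p = complProj J P p := by
  have hq : ((1 - p : ℝ) : ℂ) ≠ 0 := by
    exact_mod_cast (sub_pos.2 hp).ne'
  have hJQJ := mul_compl_mul hJ hJPJ
  unfold complProj
  generalize ((1 - p : ℝ) : ℂ) = q at *
  obtain ⟨Q, hQ⟩ : ∃ Q, Q = 1 - P := ⟨_, rfl⟩
  have hPQ : P * Q = 0 := by rw [hQ, mul_sub, hP, mul_one, sub_self]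
  have hQP : Q * P = 0 := by rw [hQ, sub_mul, hP, one_mul, sub_self]
  have hQQ : Q * Q = Q := by nth_rewrite 2 [hQ]; rw [mul_sub, mul_one, hQP, sub_zero]
  rw [← hQ] at hJQJ ⊢
  have e1 : P * (Q * J * Q) = 0 := by rw [mul_assoc, ← mul_assoc P, hPQ, zero_mul]
  have e2 : (Q * J * Q) * P = 0 := by rw [mul_assoc, hQP, mul_zero]
  have e3 : J * (Q * J * Q) = q • (J * Q) := by
    rw [← mul_assoc, ← mul_assoc, hJQJ, smul_mul_assoc]
  have e4 : (Q * J * Q) * J = q • (Q * J) := by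
    rw [mul_assoc, mul_assoc, ← mul_assoc J, hJQJ, mul_smul_comm]
  have e5 : (Q * J * Q) * (Q * J * Q) = q • (Q * J * Q) := by
    rw [mul_assoc, ← mul_assoc Q (Q * J), ← mul_assoc Q Q, hQQ, mul_assoc Q J,
      e3, mul_smul_comm, mul_assoc]
  have hq1 : q⁻¹ * q = 1 := inv_mul_cancel₀ hq
  simp only [mul_add, add_mul, mul_sub, sub_mul, smul_mul_assoc, mul_smul_comm, e1, e2, e3, e4, e5,
    hP, hJ, smul_smul, hq1, one_smul, smul_zero]
  have hPe : P = 1 - Q := by rw [hQ]; abel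
  rw [hPe]
  simp only [mul_sub, sub_mul, mul_one, one_mul, smul_add, smul_sub, smul_smul, hq1, one_smul,
    smul_zero]
  abel

theorem complProj_isSymmetric (hJs : J.IsSymmetric) (hPs : P.IsSymmetric) :
    (complProj J P p).IsSymmetric := by
  intro x y
  have h1 : ∀ x y, inner ℂ (x - P x) y = inner ℂ x (y - P y) := fun x y => by
    rw [inner_sub_left, inner_sub_right, hPs x y]
  have h2 : ∀ x, ((1 - P) * J * (1 - P)) x = J (x - P x) - P (J (x - P x)) := fun x => rfl
  simp only [complProj, LinearMap.add_apply, LinearMap.sub_apply, LinearMap.smul_apply, h2]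
  rw [inner_add_left, inner_add_right, inner_sub_left, inner_sub_right,
    inner_smul_left, inner_smul_right, hJs x y, hPs x y, h1, hJs, h1, ← Complex.ofReal_inv,
    Complex.conj_ofReal]

theorem complProj_mul_left (hJ : J * J = J) (hJPJ : J * P * J = (p : ℂ) • J) (hp : p < 1) :
    complProj J P p * J = 0 := by
  have hq : ((1 - p : ℝ) : ℂ) ≠ 0 := by
    exact_mod_cast (sub_pos.2 hp).ne'
  have hJQJ := mul_compl_mul hJ hJPJ
  unfold complProj
  rw [add_mul, sub_mul, smul_mul_assoc, mul_assoc (1 - P), mul_assoc (1 - P), hJQJ,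
    mul_smul_comm, smul_smul, inv_mul_cancel₀ hq, hJ, one_smul, sub_mul, one_mul]
  abel

/-- For `P J` the relation `J P J = p J` gives equality; Cauchy–Schwarz transfers the bound to the
adjoint `J P`. -/
theorem norm_mul_apply_sq_le (hJs : J.IsSymmetric) (hJ : J * J = J) (hPs : P.IsSymmetric)
    (hP : P * P = P) (hJPJ : J * P * J = (p : ℂ) • J) (hp : 0 ≤ p) (x : E) :
    ‖J (P x)‖ ^ 2 ≤ p * ‖P x‖ ^ 2 := by
  have hJJ : ∀ x, J (J x) = J x := fun x => congrArg (fun f : Module.End ℂ E => f x) hJ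
  have hPP : ∀ x, P (P x) = P x := fun x => congrArg (fun f : Module.End ℂ E => f x) hP
  have hJPJ' : ∀ x, J (P (J x)) = (p : ℂ) • J x :=
    fun x => congrArg (fun f : Module.End ℂ E => f x) hJPJ
  set y := P x
  have h2 : ‖P (J y)‖ ^ 2 = p * ‖J y‖ ^ 2 := by
    have : inner ℂ (P (J y)) (P (J y)) = (p : ℂ) * inner ℂ (J y) (J y) := by
      rw [hPs, hPP, hJs, hJPJ', inner_smul_right, hJs, hJJ]
    have := congrArg Complex.re this
    rw [Complex.re_ofReal_mul] at this
    rwa [← inner_self_eq_norm_sq (𝕜 := ℂ), ← inner_self_eq_norm_sq (𝕜 := ℂ)]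
  have h1 : ‖J y‖ ^ 2 ≤ ‖y‖ * ‖P (J y)‖ := by
    have : inner ℂ (J y) (J y) = inner ℂ y (P (J y)) := by
      rw [hJs, hJJ, ← hPs, hPP]
    rw [← inner_self_eq_norm_sq (𝕜 := ℂ), this]
    exact (Complex.re_le_norm _).trans (norm_inner_le_norm _ _)
  rcases (sq_nonneg ‖J y‖).eq_or_lt with h | h
  · rw [← h]
    positivity
  · have h3 := mul_self_le_mul_self h.le h1
    have h4 : ‖J y‖ ^ 2 * ‖J y‖ ^ 2 ≤ ‖J y‖ ^ 2 * (p * ‖y‖ ^ 2) := by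
      calc _ ≤ _ := h3
        _ = ‖y‖ ^ 2 * ‖P (J y)‖ ^ 2 := by ring
        _ = _ := by rw [h2]; ring
    exact le_of_mul_le_mul_left h4 h

theorem norm_complProj_sub_le (hJs : J.IsSymmetric) (hJ : J * J = J) (hPs : P.IsSymmetric)
    (hP : P * P = P) (hJPJ : J * P * J = (p : ℂ) • J) (hp : 0 ≤ p) (hp1 : p < 1) (x : E) :
    ‖complProj J P p x - P x‖ ≤ √p * ‖x‖ := by
  have hq : 0 < 1 - p := sub_pos.2 hp1
  have hQs : (1 - P).IsSymmetric := LinearMap.IsSymmetric.id.sub hPs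
  have hQ : (1 - P) * (1 - P) = 1 - P := by
    rw [mul_sub, mul_one, sub_mul, one_mul, hP, sub_self, sub_zero]
  have hJQJ := mul_compl_mul hJ hJPJ
  have hα := norm_mul_apply_sq_le hJs hJ hPs hP hJPJ hp x
  have hβ := norm_mul_apply_sq_le hJs hJ hQs hQ hJQJ hq.le x
  have hJJ : ∀ x, J (J x) = J x := fun x => congrArg (fun f : Module.End ℂ E => f x) hJ
  have hpy := norm_sq_eq_of_isSymmetric_of_idem hPs hP x
  have hQx : (1 - P) x = x - P x := rfl
  rw [hQx] at hβ
  set β := J (x - P x) with hβdef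
  set α := J (P x) with hαdef
  have hJβ : J β = β := hJJ _
  have hJα : J α = α := hJJ _
  have hJPβ : J (β - P β) = ((1 - p : ℝ) : ℂ) • β :=
    congrArg (fun f : Module.End ℂ E => f (x - P x)) hJQJ
  have hR : complProj J P p x - P x = -(α + β - ((1 - p : ℝ) : ℂ)⁻¹ • (β - P β)) := by
    have h2 : ((1 - P) * J * (1 - P)) x = β - P β := rfl
    have h3 : J x = α + β := by rw [hαdef, hβdef, map_sub]; abel
    simp only [complProj, LinearMap.add_apply, LinearMap.sub_apply, LinearMap.smul_apply, h2, h3]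
    abel
  have hββ : inner ℂ (β - P β) (β - P β) = ((1 - p : ℝ) : ℂ) * inner ℂ β β := by
    have : inner ℂ ((1 - P) β) ((1 - P) β) = inner ℂ β (((1 - P) * (1 - P)) β) := hQs _ _
    rw [hQ] at this
    change inner ℂ (β - P β) (β - P β) = inner ℂ β (β - P β) at this
    rw [this]
    nth_rewrite 1 [← hJβ]
    rw [hJs, hJPβ, inner_smul_right]
  have hγβ : inner ℂ (α + β) (β - P β) = ((1 - p : ℝ) : ℂ) * inner ℂ (α + β) β := by
    have : J (α + β) = α + β := by rw [map_add, hJα, hJβ]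
    nth_rewrite 1 [← this]
    rw [hJs, hJPβ, inner_smul_right]
  -- The cross terms between `α` and `β` cancel, so the bounds for `J P` and `J (1 - P)` add up to
  -- `p * ‖x‖ ^ 2`.
  have hnorm : ‖complProj J P p x - P x‖ ^ 2 = ‖α‖ ^ 2 + p / (1 - p) * ‖β‖ ^ 2 := by
    rw [hR, norm_neg, @norm_sub_sq ℂ, inner_smul_right, hγβ, norm_smul, mul_pow,
      ← inner_self_eq_norm_sq (𝕜 := ℂ) (β - P β), hββ, @norm_add_sq ℂ, inner_add_left,
      ← mul_assoc, inv_mul_cancel₀ (by exact_mod_cast hq.ne'), one_mul, map_add,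
      inner_self_eq_norm_sq (𝕜 := ℂ)]
    have h1 : RCLike.re (((1 - p : ℝ) : ℂ) * inner ℂ β β) = (1 - p) * ‖β‖ ^ 2 := by
      rw [← inner_self_eq_norm_sq (𝕜 := ℂ)]
      exact Complex.re_ofReal_mul _ _
    rw [h1, norm_inv, Complex.norm_real, Real.norm_of_nonneg hq.le]
    field_simp
    ring
  refine le_of_sq_le_sq ?_ (by positivity)
  rw [hnorm, mul_pow, Real.sq_sqrt hp, hpy]
  have : p / (1 - p) * ‖β‖ ^ 2 ≤ p / (1 - p) * ((1 - p) * ‖x - P x‖ ^ 2) := by gcongr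
  have e : p / (1 - p) * ((1 - p) * ‖x - P x‖ ^ 2) = p * ‖x - P x‖ ^ 2 := by
    field_simp
  linarith

end ProjectionPair

/-! ### Weighting by a projection -/

section Weight

variable {E : Type*} [NormedAddCommGroup E] [InnerProductSpace ℂ E]

/-- Acts as `1` on the kernel and as `l` on the range of the projection `R`. -/
def weight (R : Module.End ℂ E) (l : ℝ) : Module.End ℂ E := 1 + ((l - 1 : ℝ) : ℂ) • R

variable {R : Module.End ℂ E} {l : ℝ}

theorem norm_weight_sq (hs : R.IsSymmetric) (hi : R * R = R) (x : E) :
    ‖weight R l x‖ ^ 2 = ‖x - R x‖ ^ 2 + l ^ 2 * ‖R x‖ ^ 2 := by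
  have hRR : R (R x) = R x := congrArg (fun f : Module.End ℂ E => f x) hi
  have h1 : R (weight R l x) = (l : ℂ) • R x := by
    simp only [weight, LinearMap.add_apply, Module.End.one_apply, LinearMap.smul_apply, map_add,
      map_smul, hRR]
    rw [Complex.ofReal_sub, sub_smul, Complex.ofReal_one, one_smul]
    abel
  have h2 : weight R l x - (l : ℂ) • R x = x - R x := by
    simp only [weight, LinearMap.add_apply, Module.End.one_apply, LinearMap.smul_apply]
    rw [Complex.ofReal_sub, sub_smul, Complex.ofReal_one, one_smul]
    abel
  rw [norm_sq_eq_of_isSymmetric_of_idem hs hi (weight R l x), h1, h2, norm_smul, mul_pow]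
  simp

theorem norm_le_norm_weight (hs : R.IsSymmetric) (hi : R * R = R) (hl : 1 ≤ l) (x : E) :
    ‖x‖ ≤ ‖weight R l x‖ := by
  refine le_of_sq_le_sq ?_ (norm_nonneg _)
  rw [norm_weight_sq hs hi, norm_sq_eq_of_isSymmetric_of_idem hs hi x]
  have : 1 ≤ l ^ 2 := one_le_pow₀ hl
  nlinarith [sq_nonneg ‖R x‖]

/-- The norm of the shear `(a, s) ↦ (a + θ s, s)` is at most `exp (θ / 2)`. -/
theorem shear_sq_le {a s θ : ℝ} (ha : 0 ≤ a) (hs : 0 ≤ s) (hθ : 0 ≤ θ) :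
    (a + θ * s) ^ 2 + s ^ 2 ≤ Real.exp (θ / 2) ^ 2 * (a ^ 2 + s ^ 2) := by
  have h1 : θ / 2 ≤ Real.sinh (θ / 2) := Real.self_le_sinh_iff.2 (by positivity)
  rw [Real.sinh_eq, Real.exp_neg] at h1
  set g := Real.exp (θ / 2)
  have hg : 0 < g := Real.exp_pos _
  have hθ' : θ ≤ g - g⁻¹ := by linarith
  have h0 : 0 ≤ g - g⁻¹ := hθ.trans hθ'
  calc (a + θ * s) ^ 2 + s ^ 2 ≤ (a + (g - g⁻¹) * s) ^ 2 + s ^ 2 := by gcongr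
    -- For shear parameter `g - g⁻¹` the quadratic form has eigenvalues `g ^ 2` and `g⁻¹ ^ 2`; the
    -- square is the defect from the larger one.
    _ = g ^ 2 * (a ^ 2 + s ^ 2) - (g - g⁻¹) / g * (g * a - s) ^ 2 := by
      field_simp
      ring
    _ ≤ _ := sub_le_self _ (by positivity)

/-- As `O` preserves norms, only the flow from the kernel of `R` into its range can raise the
weight, and there `R O` is the commutator. In the coordinates `(l‖R x‖, ‖x - R x‖)` this is a shear
by `l * δ`. -/
theorem norm_weight_apply_le (hs : R.IsSymmetric) (hi : R * R = R) (hl : 1 ≤ l)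
    {O : Module.End ℂ E} (hO : ∀ x, ‖O x‖ = ‖x‖) {δ : ℝ}
    (hRO : ∀ x, ‖R (O x) - O (R x)‖ ≤ δ * ‖x‖) (hδ : 0 ≤ δ) (x : E) :
    ‖weight R l (O x)‖ ≤ Real.exp (l * δ / 2) * ‖weight R l x‖ := by
  have hRR : ∀ x, R (R x) = R x := fun x => congrArg (fun f : Module.End ℂ E => f x) hi
  have hR1 := norm_apply_le_of_isSymmetric_of_idem hs hi
  have hROx : ‖R (O x)‖ ≤ ‖R x‖ + δ * ‖x - R x‖ := by
    have e : R (O x) = R (O (R x)) + R (R (O (x - R x)) - O (R (x - R x))) := by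
      simp only [map_sub, hRR, sub_self, map_zero, sub_zero]
      abel
    rw [e]
    refine (norm_add_le _ _).trans (add_le_add ?_ ?_)
    · exact (hR1 _).trans (hO _).le
    · exact (hR1 _).trans (hRO _)
  have h1 : 0 ≤ l ^ 2 - 1 := sub_nonneg.2 (one_le_pow₀ hl)
  refine le_of_sq_le_sq ?_ (by positivity)
  have hpy := norm_sq_eq_of_isSymmetric_of_idem hs hi (O x)
  have hpx := norm_sq_eq_of_isSymmetric_of_idem hs hi x
  rw [hO] at hpy
  rw [mul_pow, norm_weight_sq hs hi, norm_weight_sq hs hi]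
  have hsh := shear_sq_le (a := l * ‖R x‖) (s := ‖x - R x‖) (θ := l * δ) (by positivity)
    (by positivity) (by positivity)
  calc ‖O x - R (O x)‖ ^ 2 + l ^ 2 * ‖R (O x)‖ ^ 2
      = ‖x - R x‖ ^ 2 + ‖R x‖ ^ 2 + (l ^ 2 - 1) * ‖R (O x)‖ ^ 2 := by linarith
    _ ≤ ‖x - R x‖ ^ 2 + ‖R x‖ ^ 2 + (l ^ 2 - 1) * (‖R x‖ + δ * ‖x - R x‖) ^ 2 := by gcongr
    _ ≤ (l * ‖R x‖ + l * δ * ‖x - R x‖) ^ 2 + ‖x - R x‖ ^ 2 := by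
      have : ‖R x‖ ^ 2 ≤ (‖R x‖ + δ * ‖x - R x‖) ^ 2 := by
        gcongr
        have := mul_nonneg hδ (norm_nonneg (x - R x))
        linarith
      nlinarith
    _ ≤ _ := hsh
    _ = _ := by ring

theorem norm_sq_le_weight (hs : R.IsSymmetric) (hi : R * R = R) (hl : 0 < l)
    {P : Module.End ℂ E} (hPs : P.IsSymmetric) (hP : P * P = P) {p : ℝ} (hp : 0 ≤ p)
    (hRP : ∀ x, ‖R x - P x‖ ≤ √p * ‖x‖) (x : E) :
    ‖P x‖ ^ 2 ≤ (p + 1 / l ^ 2) * ‖weight R l x‖ ^ 2 := by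
  have hRR : R (R x) = R x := congrArg (fun f : Module.End ℂ E => f x) hi
  have hPP : ∀ x, P (P x) = P x := fun x => congrArg (fun f : Module.End ℂ E => f x) hP
  have hP1 := norm_apply_le_of_isSymmetric_of_idem hPs hP
  have h : ‖P x‖ ≤ √p * ‖x - R x‖ + ‖R x‖ := by
    have e : P x = -P (R (x - R x) - P (x - R x)) + P (R x) := by
      simp only [map_sub, map_neg, hRR, hPP, sub_self, zero_sub]
      abel
    rw [e]
    refine (norm_add_le _ _).trans (add_le_add ?_ (hP1 _))
    rw [norm_neg]
    exact (hP1 _).trans (hRP _)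
  rw [norm_weight_sq hs hi]
  refine (pow_le_pow_left₀ (norm_nonneg _) h 2).trans ?_
  have hsq : √p ^ 2 = p := Real.sq_sqrt hp
  -- Lagrange's identity for the vectors `(√p, 1/l)` and `(‖x - R x‖, l‖R x‖)`.
  have e : (p + 1 / l ^ 2) * (‖x - R x‖ ^ 2 + l ^ 2 * ‖R x‖ ^ 2)
      = (√p * ‖x - R x‖ + ‖R x‖) ^ 2 + (√p * l * ‖R x‖ - ‖x - R x‖ / l) ^ 2 := by
    nth_rewrite 1 [← hsq]
    field_simp
    ring
  rw [e]
  exact le_add_of_nonneg_right (sq_nonneg _)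

end Weight

/-! ### Oracle in superposition and the progress operator -/

section PurifiedOracle

open Function

variable {C X V : Type*} [Fintype C] [DecidableEq C] [Fintype X] [NormedAddCommGroup V]
  [InnerProductSpace ℂ V]

/-- Joint states of a system `V` and of a function `C → X` kept in superposition. -/
abbrev Purified (C X V : Type*) [Fintype C] [DecidableEq C] [Fintype X] [NormedAddCommGroup V] :=
  PiLp 2 (fun _ : C → X => V)

/-- The operator that acts on the system by `D h`, controlled on the function `h`. -/
def controlled (D : (C → X) → Module.End ℂ V) : Module.End ℂ (Purified C X V) where
  toFun F := WithLp.toLp 2 fun h => D h (F h)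
  map_add' F G := by ext; simp
  map_smul' a F := by ext; simp

@[simp]
theorem controlled_apply (D : (C → X) → Module.End ℂ V) (F : Purified C X V) (h : C → X) :
    controlled D F h = D h (F h) := rfl

/-- Averaging over the value of the function at `c`. -/
def average (c : C) : Module.End ℂ (Purified C X V) where
  toFun F := WithLp.toLp 2 fun h => (Fintype.card X : ℂ)⁻¹ • ∑ z, F (update h c z)
  map_add' F G := by ext; simp [Finset.sum_add_distrib]
  map_smul' a F := by ext; simp [← Finset.smul_sum, smul_comm a]

theorem average_apply (c : C) (F : Purified C X V) (h : C → X) :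
    average c F h = (Fintype.card X : ℂ)⁻¹ • ∑ z, F (update h c z) := rfl

theorem average_update (c : C) (F : Purified C X V) (h : C → X) (z : X) :
    average c F (update h c z) = average c F h := by
  simp [average_apply]

theorem average_eq_self [Nonempty X] {c : C} {F : Purified C X V}
    (hF : ∀ h z, F (update h c z) = F h) : average c F = F := by
  ext h
  simp [average_apply, hF, ← Nat.cast_smul_eq_nsmul ℂ, smul_smul]

theorem average_mul_self [Nonempty X] (c : C) :
    average c * average c = (average c : Module.End ℂ (Purified C X V)) :=
  LinearMap.ext fun _ => average_eq_self (average_update c _)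

theorem average_commute (c c' : C) :
    Commute (average c : Module.End ℂ (Purified C X V)) (average c') := by
  by_cases hc : c = c'
  · rw [hc]
  ext F h
  simp only [Module.End.mul_apply, average_apply, ← Finset.smul_sum]
  rw [Finset.sum_comm]
  simp only [update_comm hc]

theorem average_commute_controlled {c : C} {D : (C → X) → Module.End ℂ V}
    (hD : ∀ h z, D (update h c z) = D h) : Commute (average c) (controlled D) := by
  ext F h
  simp [average_apply, hD]

/-- Exchanging `h c` with `z` is an involution on pairs `(h, z)`; this is what makes `average`
symmetric. -/
theorem sum_update_eq (c : C) {M : Type*} [AddCommMonoid M] (f : (C → X) → X → M) :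
    ∑ h, ∑ z, f h z = ∑ h, ∑ z, f (update h c z) (h c) := by
  rw [← Fintype.sum_prod_type', ← Fintype.sum_prod_type']
  refine Fintype.sum_equiv ⟨fun x => (update x.1 c x.2, x.1 c), fun x => (update x.1 c x.2, x.1 c),
    fun x => by simp, fun x => by simp⟩ _ _ fun x => ?_
  simp

theorem average_isSymmetric (c : C) :
    (average c : Module.End ℂ (Purified C X V)).IsSymmetric := by
  intro F G
  simp only [PiLp.inner_apply, average_apply, inner_smul_left, inner_smul_right, sum_inner,
    inner_sum, map_inv₀, Complex.conj_natCast, ← Finset.mul_sum]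
  congr 1
  rw [sum_update_eq c]
  simp

theorem norm_controlled_eq {D : (C → X) → Module.End ℂ V} (hD : ∀ h v, ‖D h v‖ = ‖v‖)
    (F : Purified C X V) : ‖controlled D F‖ = ‖F‖ := by
  simp [PiLp.norm_eq_of_L2, hD]

theorem controlled_isSymmetric {D : (C → X) → Module.End ℂ V} (hD : ∀ h, (D h).IsSymmetric) :
    (controlled D).IsSymmetric := by
  intro F G
  simp only [PiLp.inner_apply, controlled_apply]
  exact Finset.sum_congr rfl fun h _ => hD h _ _

open Classical in
/-- The projection onto the functions that satisfy `s`. -/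
def event (s : Set (C → X)) : Module.End ℂ (Purified C X V) :=
  controlled fun h => if h ∈ s then 1 else 0

open Classical in
theorem event_apply (s : Set (C → X)) (F : Purified C X V) (h : C → X) :
    event s F h = if h ∈ s then F h else 0 := by
  simp only [event, controlled_apply]
  split_ifs <;> rfl

theorem event_mul (s t : Set (C → X)) :
    event s * event t = (event (s ∩ t) : Module.End ℂ (Purified C X V)) := by
  ext F h
  simp only [Module.End.mul_apply, event_apply, Set.mem_inter_iff]
  split_ifs <;> simp_all

theorem event_mul_self (s : Set (C → X)) :
    event s * event s = (event s : Module.End ℂ (Purified C X V)) := by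
  rw [event_mul, Set.inter_self]

theorem event_isSymmetric (s : Set (C → X)) :
    (event s : Module.End ℂ (Purified C X V)).IsSymmetric := by
  refine controlled_isSymmetric fun h => ?_
  split_ifs
  · exact LinearMap.IsSymmetric.id
  · exact LinearMap.IsSymmetric.zero

theorem average_commute_event {c : C} {s : Set (C → X)}
    (hs : ∀ h z, update h c z ∈ s ↔ h ∈ s) :
    Commute (average c : Module.End ℂ (Purified C X V)) (event s) :=
  average_commute_controlled fun h z => by
    by_cases h1 : h ∈ s
    · rw [if_pos h1, if_pos ((hs h z).2 h1)]
    · rw [if_neg h1, if_neg fun h2 => h1 ((hs h z).1 h2)]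

theorem event_commute_controlled (s : Set (C → X)) (D : (C → X) → Module.End ℂ V) :
    Commute (event s) (controlled D) := by
  ext F h
  simp only [Module.End.mul_apply, event_apply, controlled_apply]
  split_ifs
  · rfl
  · exact (map_zero _).symm

open Classical in
theorem norm_event_sq (s : Set (C → X)) (F : Purified C X V) :
    ‖event s F‖ ^ 2 = ∑ h, if h ∈ s then ‖F h‖ ^ 2 else 0 := by
  rw [PiLp.norm_sq_eq_of_L2]
  refine Finset.sum_congr rfl fun h _ => ?_
  rw [event_apply]
  split_ifs <;> simp

/-- The probability that a uniformly random value lies in `T`. -/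
def density (T : Finset X) : ℝ := (T.card : ℝ) / Fintype.card X

theorem density_nonneg (T : Finset X) : 0 ≤ density T := by
  unfold density; positivity

/-- The projection onto the functions whose value at `c` is in `T`. -/
abbrev hit (T : Finset X) (c : C) : Module.End ℂ (Purified C X V) := event {h | h c ∈ T}

theorem average_hit_average [Nonempty X] (T : Finset X) (c : C) :
    average c * hit T c * average c =
      ((density T : ℝ) : ℂ) • (average c : Module.End ℂ (Purified C X V)) := by
  classical
  ext F h
  simp only [Module.End.mul_apply, LinearMap.smul_apply, PiLp.smul_apply]
  rw [average_apply]
  simp only [hit, event_apply, Set.mem_ofPred_eq, update_self, average_update]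
  simp only [Finset.sum_ite_mem, Finset.univ_inter, Finset.sum_const,
    ← Nat.cast_smul_eq_nsmul ℂ, smul_smul, density]
  congr 1
  push_cast
  ring

/-- The projection onto the states that carry the knowledge that the value at `c` is in `T`. -/
def known (T : Finset X) (c : C) : Module.End ℂ (Purified C X V) :=
  complProj (average c) (hit T c) (density T)

section known

variable {T : Finset X}

theorem known_isSymmetric (T : Finset X) (c : C) :
    (known T c : Module.End ℂ (Purified C X V)).IsSymmetric :=
  complProj_isSymmetric (average_isSymmetric c) (event_isSymmetric _)

theorem known_mul_self [Nonempty X] (hT : density T < 1) (c : C) :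
    known T c * known T c = (known T c : Module.End ℂ (Purified C X V)) :=
  complProj_mul_self (average_mul_self c) (event_mul_self _) (average_hit_average T c) hT

theorem known_apply_eq_zero [Nonempty X] (hT : density T < 1) {c : C} {F : Purified C X V}
    (hF : ∀ h z, F (update h c z) = F h) : known T c F = 0 := by
  have := complProj_mul_left (average_mul_self c) (average_hit_average T c) hT (E := Purified C X V)
  rw [← average_eq_self hF]
  exact congrArg (fun f : Module.End ℂ (Purified C X V) => f F) this

theorem norm_known_sub_hit_le [Nonempty X] (hT : density T < 1) (c : C) (F : Purified C X V) :
    ‖known T c F - hit T c F‖ ≤ √(density T) * ‖F‖ := by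
  exact norm_complProj_sub_le (E := Purified C X V) (J := average c) (P := hit T c)
    (average_isSymmetric c) (average_mul_self c) (event_isSymmetric _) (event_mul_self _)
    (average_hit_average T c) (density_nonneg T) hT F

/-- `known T c` is a polynomial in `average c` and `hit T c`. -/
theorem known_commute_of_commute {c : C} {A : Module.End ℂ (Purified C X V)}
    (h1 : Commute (average c) A) (h2 : Commute (hit T c) A) : Commute (known T c) A := by
  have h3 := (Commute.one_left A).sub_left h2
  exact (h2.sub_left h1).add_left (((h3.mul_left h1).mul_left h3).smul_left _)

theorem known_commute_controlled {c : C} {D : (C → X) → Module.End ℂ V}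
    (hD : ∀ h z, D (update h c z) = D h) : Commute (known T c) (controlled D) :=
  known_commute_of_commute (average_commute_controlled hD) (event_commute_controlled _ _)

theorem known_commute_event {c : C} {s : Set (C → X)}
    (hs : ∀ h z, update h c z ∈ s ↔ h ∈ s) :
    Commute (known T c : Module.End ℂ (Purified C X V)) (event s) :=
  known_commute_of_commute (average_commute_event hs) (event_commute_controlled _ _)

theorem known_commute (c c' : C) :
    Commute (known T c : Module.End ℂ (Purified C X V)) (known T c') := by
  by_cases hc : c = c'
  · rw [hc]
  refine known_commute_of_commute ?_ ?_
  · refine (known_commute_of_commute (average_commute _ _) ?_).symm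
    refine (average_commute_event fun h z => ?_).symm
    simp [update_of_ne (Ne.symm hc)]
  · refine (known_commute_event fun h z => ?_).symm
    simp [update_of_ne hc]

end known

theorem weight_known_pairwise_commute (T : Finset X) (l : ℝ) (S : Finset C) :
    (S : Set C).Pairwise
      (Commute on fun c => weight (known T c : Module.End ℂ (Purified C X V)) l) :=
  fun c _ c' _ _ => (Commute.one_left _).add_left <| (((Commute.one_right _).add_right
    ((known_commute c c').smul_right _))).smul_left _

/-- The operator that multiplies by `l` for every cell of `S` known to have its value in `T`. -/
def progress (T : Finset X) (l : ℝ) (S : Finset C) : Module.End ℂ (Purified C X V) :=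
  S.noncommProd (fun c => weight (known T c) l) (weight_known_pairwise_commute T l S)

section progress

variable {T : Finset X} {l : ℝ}

theorem progress_empty (F : Purified C X V) : progress T l ∅ F = F := by
  unfold progress
  rw [Finset.noncommProd_empty, Module.End.one_apply]

theorem progress_erase {S : Finset C} {c : C} (hc : c ∈ S) (F : Purified C X V) :
    progress T l S F = weight (known T c) l (progress T l (S.erase c) F) := by
  have := S.mul_noncommProd_erase hc (fun c => weight (known (V := V) T c) l)
    (weight_known_pairwise_commute T l S)
  exact (congrArg (fun f : Module.End ℂ (Purified C X V) => f F) this).symm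

theorem progress_commute {S : Finset C} {A : Module.End ℂ (Purified C X V)}
    (hA : ∀ c ∈ S, Commute (known T c) A) : Commute (progress T l S) A :=
  (Finset.noncommProd_commute _ _ _ _ fun c hc =>
    ((Commute.one_left _).add_left ((hA c hc).smul_left _)).symm).symm

theorem progress_apply_eq_self [Nonempty X] (hT : density T < 1) (S : Finset C)
    {F : Purified C X V} (hF : ∀ c h z, F (update h c z) = F h) : progress T l S F = F := by
  induction S using Finset.induction with
  | empty => simp [progress_empty]
  | insert c S hc ih =>
    rw [progress_erase (Finset.mem_insert_self c S), Finset.erase_insert hc, ih]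
    simp [weight, known_apply_eq_zero hT (hF c)]

theorem norm_le_norm_progress [Nonempty X] (hT : density T < 1) (hl : 1 ≤ l) (S : Finset C)
    (F : Purified C X V) : ‖F‖ ≤ ‖progress T l S F‖ := by
  induction S using Finset.induction with
  | empty => simp [progress_empty]
  | insert c S hc ih =>
    rw [progress_erase (Finset.mem_insert_self c S), Finset.erase_insert hc]
    exact ih.trans (norm_le_norm_weight (known_isSymmetric T c) (known_mul_self hT c) hl _)

theorem norm_hit_progress_sq_le [Nonempty X] (hT : density T < 1) (hl : 0 < l) {S : Finset C}
    {c : C} (hc : c ∈ S) (F : Purified C X V) :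
    ‖hit T c (progress T l (S.erase c) F)‖ ^ 2 ≤
      (density T + 1 / l ^ 2) * ‖progress T l S F‖ ^ 2 := by
  rw [progress_erase hc]
  exact norm_sq_le_weight (E := Purified C X V) (R := known T c) (P := hit T c)
    (known_isSymmetric T c) (known_mul_self hT c) hl (event_isSymmetric _)
    (event_mul_self _) (density_nonneg T) (norm_known_sub_hit_le hT c) _

/-- A controlled unitary increases the weight of a single cell moderately. -/
theorem norm_weight_controlled_le [Nonempty X] (hT : density T < 1) (hl : 1 ≤ l) (c : C)
    {D : (C → X) → Module.End ℂ V} (hD : ∀ h v, ‖D h v‖ = ‖v‖) (F : Purified C X V) :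
    ‖weight (known T c) l (controlled D F)‖ ≤
      Real.exp (l * √(density T)) * ‖weight (known T c) l F‖ := by
  have hO := norm_controlled_eq hD
  have := norm_weight_apply_le (E := Purified C X V) (R := known T c)
    (known_isSymmetric T c) (known_mul_self hT c) hl hO
    (δ := 2 * √(density T)) (fun x => ?_) (by positivity) F
  · rwa [mul_left_comm, mul_div_cancel_left₀ _ two_ne_zero] at this
  -- `hit` is diagonal in `h` and so commutes with `controlled D`; replacing `known` by `hit` on
  -- both sides costs `√(density T)` each.
  · have e : known T c (controlled D x) - controlled D (known T c x) =
        (known T c (controlled D x) - hit T c (controlled D x)) -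
          controlled D (known T c x - hit T c x) := by
      have : hit T c (controlled D x) = controlled D (hit T c x) :=
        congrArg (fun f : Module.End ℂ (Purified C X V) => f x) (event_commute_controlled _ D).eq
      rw [map_sub, this]
      abel
    rw [e]
    refine (norm_sub_le _ _).trans ?_
    rw [hO]
    have h1 := norm_known_sub_hit_le hT c (controlled D x)
    have h2 := norm_known_sub_hit_le hT c x
    rw [hO] at h1
    linarith

end progress

end PurifiedOracle

/-! ### Splitting by oracle values and by queried cells -/

section FiberDecomposition

open Function

variable {C X V : Type*} [Fintype C] [DecidableEq C] [Fintype X] [NormedAddCommGroup V]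
  [InnerProductSpace ℂ V]

/-- Different values at `c` give orthogonal components. This handles adaptivity: once the value `z`
is fixed, the rest of the chain has a fixed starting point. -/
theorem norm_event_sq_eq_sum (T : Finset X) (c : C) (s : X → Set (C → X)) (F : Purified C X V) :
    ‖event {h | h c ∈ T ∧ h ∈ s (h c)} F‖ ^ 2 =
      ∑ z ∈ T, ‖event (s z) (event {h | h c = z} F)‖ ^ 2 := by
  classical
  simp only [norm_event_sq]
  rw [Finset.sum_comm]
  refine Finset.sum_congr rfl fun h _ => ?_
  simp only [event_apply, Set.mem_ofPred_eq]
  have : ∀ z ∈ T, (if h ∈ s z then ‖if h c = z then F h else 0‖ ^ 2 else 0) =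
      if h c = z then (if h ∈ s (h c) then ‖F h‖ ^ 2 else 0) else 0 := fun z _ => by
    by_cases hz : h c = z
    · subst hz; simp
    · simp [hz]
  rw [Finset.sum_congr rfl this, Finset.sum_ite_eq]
  split_ifs <;> simp_all

theorem norm_hit_sq_eq_sum (T : Finset X) (c : C) (F : Purified C X V) :
    ‖hit T c F‖ ^ 2 = ∑ z ∈ T, ‖event {h | h c = z} F‖ ^ 2 := by
  have := norm_event_sq_eq_sum T c (fun _ => Set.univ) F
  simp only [Set.mem_univ, and_true] at this
  rw [hit, this]
  refine Finset.sum_congr rfl fun z _ => ?_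
  have e : event Set.univ * event {h : C → X | h c = z} =
      (event {h | h c = z} : Module.End ℂ (Purified C X V)) := by
    rw [event_mul, Set.univ_inter]
  rw [← Module.End.mul_apply, e]

variable {B : Type*}

open Classical in
/-- The projection of the system onto the span of the basis vectors in `s`. -/
def restrict (s : Set B) : Module.End ℂ (EuclideanSpace ℂ B) where
  toFun v := WithLp.toLp 2 fun b => if b ∈ s then v b else 0
  map_add' v w := by ext b; simp only [PiLp.add_apply]; split_ifs <;> simp
  map_smul' a v := by ext b; simp only [PiLp.smul_apply]; split_ifs <;> simp

open Classical in
theorem restrict_apply (s : Set B) (v : EuclideanSpace ℂ B) (b : B) :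
    restrict s v b = if b ∈ s then v b else 0 := rfl

variable [Fintype B]

/-- The projection of the joint system onto the basis vectors in `s`. -/
abbrev measured (C X : Type*) [Fintype C] [DecidableEq C] [Fintype X] (s : Set B) :
    Module.End ℂ (Purified C X (EuclideanSpace ℂ B)) :=
  controlled fun _ => restrict s

theorem known_commute_measured (T : Finset X) (c : C) (s : Set B) :
    Commute (known T c) (measured C X s) :=
  known_commute_controlled (D := fun _ => restrict s) fun _ _ => rfl

theorem progress_measured (T : Finset X) (l : ℝ) (S : Finset C) (s : Set B)
    (F : Purified C X (EuclideanSpace ℂ B)) :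
    progress T l S (measured C X s F) = measured C X s (progress T l S F) :=
  LinearMap.congr_fun (progress_commute fun c _ => known_commute_measured T c s).eq F

theorem weight_known_measured (T : Finset X) (l : ℝ) (c : C) (s : Set B)
    (F : Purified C X (EuclideanSpace ℂ B)) :
    weight (known T c) l (measured C X s F) = measured C X s (weight (known T c) l F) := by
  have h := LinearMap.congr_fun (known_commute_measured T c s).eq F
  simp only [Module.End.mul_apply] at h
  simp only [weight, LinearMap.add_apply, Module.End.one_apply, LinearMap.smul_apply, map_add,
    map_smul, h]

theorem norm_sq_eq_sum_measured {ι : Type*} [Fintype ι] (f : B → ι)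
    (F : Purified C X (EuclideanSpace ℂ B)) :
    ‖F‖ ^ 2 = ∑ j, ‖measured C X {b | f b = j} F‖ ^ 2 := by
  classical
  simp only [PiLp.norm_sq_eq_of_L2, controlled_apply, restrict_apply, Set.mem_ofPred_eq]
  rw [Finset.sum_comm (s := (Finset.univ : Finset ι))]
  refine Finset.sum_congr rfl fun h _ => ?_
  rw [Finset.sum_comm (s := (Finset.univ : Finset ι))]
  refine Finset.sum_congr rfl fun b _ => ?_
  simp [apply_ite norm, ite_pow]

theorem norm_restrict_singleton_sq (v : EuclideanSpace ℂ B) (b : B) :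
    ‖restrict {b' | b' = b} v‖ ^ 2 = ‖v b‖ ^ 2 := by
  classical
  simp [PiLp.norm_sq_eq_of_L2, restrict_apply, apply_ite norm, ite_pow]

/-- A controlled unitary that, on the basis vector `b`, only depends on the cell `f b`, increases
the weight moderately. -/
theorem norm_progress_controlled_le [Nonempty X] {T : Finset X} {l : ℝ} (hT : density T < 1)
    (hl : 1 ≤ l) (f : B → C) {D : (C → X) → Module.End ℂ (EuclideanSpace ℂ B)}
    (hD : ∀ h v, ‖D h v‖ = ‖v‖) (hcomm : ∀ c h, Commute (restrict {b | f b = c}) (D h))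
    (hloc : ∀ c c', c' ≠ c → ∀ h z,
      restrict {b | f b = c} * D (update h c' z) = restrict {b | f b = c} * D h)
    (F : Purified C X (EuclideanSpace ℂ B)) :
    ‖progress T l Finset.univ (controlled D F)‖ ≤
      Real.exp (l * √(density T)) * ‖progress T l Finset.univ F‖ := by
  refine le_of_sq_le_sq ?_ (by positivity)
  rw [mul_pow, norm_sq_eq_sum_measured f,
    norm_sq_eq_sum_measured f (progress T l Finset.univ F), Finset.mul_sum]
  refine Finset.sum_le_sum fun c _ => ?_
  rw [← mul_pow]
  refine pow_le_pow_left₀ (norm_nonneg _) ?_ 2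
  -- On the fibre over `c` the operator ignores all other cells, so their factors pass through and
  -- only the factor of `c` can grow.
  have h1 : progress T l (Finset.univ.erase c) (measured C X {b | f b = c} (controlled D F)) =
      measured C X {b | f b = c} (controlled D (progress T l (Finset.univ.erase c) F)) :=
    LinearMap.congr_fun (progress_commute fun c' hc' => known_commute_controlled
      (D := fun h => restrict {b | f b = c} * D h)
      (hloc c c' (Finset.ne_of_mem_erase hc'))).eq F
  have h2 : ∀ G, measured C X {b | f b = c} (controlled D G) =
      controlled D (measured C X {b | f b = c} G) := fun G =>
    PiLp.ext fun h => LinearMap.congr_fun (hcomm c h).eq (G h)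
  rw [progress_erase (Finset.mem_univ c), progress_erase (Finset.mem_univ c),
    ← weight_known_measured, ← weight_known_measured, ← progress_measured, h1, h2]
  exact norm_weight_controlled_le hT hl c hD _

end FiberDecomposition

/-! ### Growth under queries and the cost of a chain -/

section Bound

open Function

variable {N κ : ℕ} {Y W : Type*} [Fintype Y] [Fintype W]

theorem queryUnitary_apply (h : Oracles N κ Y) (v : State N κ Y W) (b : Register N κ Y W) :
    queryUnitary W h v b = v (b.1, b.2.1 ^^^ h b.1.1 b.1.2, b.2.2) := rfl

theorem norm_stateAfter (A : Adversary N κ Y W) (h : Oracles N κ Y) (n : ℕ) :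
    ‖A.stateAfter h n‖ = 1 := by
  induction n with
  | zero => rw [Adversary.stateAfter, LinearIsometryEquiv.norm_map, A.norm_init]
  | succ n ih =>
    rw [Adversary.stateAfter, LinearIsometryEquiv.norm_map, LinearIsometryEquiv.norm_map, ih]

theorem successProb_le_one (A : Adversary N κ Y W) (t : ℕ) (x₀ : BitVec κ) (k : ℕ) :
    successProb A t x₀ k ≤ 1 := by
  classical
  refine div_le_one_of_le₀ ?_ (Nat.cast_nonneg _)
  refine (Finset.sum_le_card_nsmul _ _ 1 fun h _ => ?_).trans (by simp)
  have := norm_stateAfter A h A.queries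
  rw [← one_pow 2, ← this, PiLp.norm_sq_eq_of_L2]
  refine Finset.sum_le_sum fun b _ => ?_
  split_ifs
  · rfl
  · positivity

variable [DecidableEq Y]

/-- The inputs of the family of oracles. -/
abbrev Cell (N κ : ℕ) (Y : Type*) := Fin N × BitVec κ × Y

/-- Joint states of the adversary and of the oracles. -/
abbrev Joint (N κ : ℕ) (Y W : Type*) [Fintype Y] [DecidableEq Y] [Fintype W] :=
  Purified (Cell N κ Y) (BitVec κ) (State N κ Y W)

/-- The query operator on the joint system. -/
def jointQuery (N κ : ℕ) (Y W : Type*) [Fintype Y] [DecidableEq Y] [Fintype W] :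
    Module.End ℂ (Joint N κ Y W) :=
  controlled fun h => (queryUnitary W (curry h)).toLinearEquiv.toLinearMap

variable {T : Finset (BitVec κ)} {l : ℝ}

theorem norm_progress_jointQuery_le (hT : density T < 1) (hl : 1 ≤ l) (F : Joint N κ Y W) :
    ‖progress T l Finset.univ (jointQuery N κ Y W F)‖ ≤
      Real.exp (l * √(density T)) * ‖progress T l Finset.univ F‖ := by
  classical
  refine norm_progress_controlled_le hT hl (fun b : Register N κ Y W => b.1)
    (fun h v => (queryUnitary W (curry h)).norm_map v) (fun c h => ?_) (fun c c' hc h z => ?_) F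
  · ext v b
    simp only [Module.End.mul_apply, restrict_apply, LinearEquiv.coe_coe,
      LinearIsometryEquiv.coe_toLinearEquiv, queryUnitary_apply, Set.mem_ofPred_eq]
    split_ifs <;> rfl
  · ext v b
    simp only [Module.End.mul_apply, restrict_apply, LinearEquiv.coe_coe,
      LinearIsometryEquiv.coe_toLinearEquiv, queryUnitary_apply, Set.mem_ofPred_eq]
    split_ifs with hb
    · have : curry (update h c' z) b.1.1 b.1.2 = curry h b.1.1 b.1.2 :=
        update_of_ne (fun e => hc (e.symm.trans hb)) _ _
      rw [this]
    · rfl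

/-- Induction on the number of links, with the set `S` of unused cells varying. A link at index `i`
erases a cell of index `i`, which no later link can need; the separate oracles `h_i` thus ensure
that no factor is used twice. -/
theorem norm_event_isChainFrom_sq_le {t : ℕ} (hTt : ∀ z, z ∈ T ↔ z.toNat < t)
    (hT : density T < 1) (hl : 1 ≤ l) (k : ℕ) :
    ∀ (i : ℕ) (x : BitVec κ) (ys : List Y) (S : Finset (Cell N κ Y)) (F : Joint N κ Y W),
      (∀ c : Cell N κ Y, i ≤ c.1 → c ∈ S) → k ≤ ys.length →
      ‖event {h | IsChainFrom (curry h) t i x ys} F‖ ^ 2 ≤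
        (density T + 1 / l ^ 2) ^ k * ‖progress T l S F‖ ^ 2 := by
  induction k with
  | zero =>
    intro i x ys S F _ _
    rw [pow_zero, one_mul]
    refine pow_le_pow_left₀ (norm_nonneg _) ?_ 2
    exact (norm_apply_le_of_isSymmetric_of_idem (event_isSymmetric _) (event_mul_self _) F).trans
      (norm_le_norm_progress hT hl S F)
  | succ k ih =>
    intro i x ys S F hS hk
    have hs : 0 ≤ density T + 1 / l ^ 2 := add_nonneg (density_nonneg T) (by positivity)
    obtain _ | ⟨y, ys⟩ := ys
    · simp at hk
    by_cases hi : i < N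
    · set c : Cell N κ Y := (⟨i, hi⟩, x, y)
      have hset : {h : Cell N κ Y → BitVec κ | IsChainFrom (curry h) t i x (y :: ys)} =
          {h | h c ∈ T ∧ h ∈ (fun z : BitVec κ =>
            {h : Cell N κ Y → BitVec κ | IsChainFrom (curry h) t (i + 1) z ys}) (h c)} := by
        ext h
        simp only [Set.mem_ofPred_eq, IsChainFrom, hTt]
        exact exists_prop_of_true hi
      have hS' : ∀ c' : Cell N κ Y, i + 1 ≤ c'.1 → c' ∈ S.erase c := fun c' hc' =>
        Finset.mem_erase.2 ⟨fun e => by simp [e, c] at hc', hS c' (by omega)⟩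
      -- With the factor of `c` removed, fixing the value at `c` commutes with the product, so the
      -- fibres reassemble into `hit T c`.
      have hcomm : ∀ z, progress T l (S.erase c) (event {h | h c = z} F) =
          event {h | h c = z} (progress T l (S.erase c) F) := fun z => by
        have : Commute (progress T l (S.erase c))
            (event {h | h c = z} : Module.End ℂ (Joint N κ Y W)) := by
          refine progress_commute fun c' hc' => known_commute_event fun h w => ?_
          simp [update_of_ne (Finset.ne_of_mem_erase hc').symm]
        exact congrArg (fun f : Module.End ℂ (Joint N κ Y W) => f F) this.eq
      rw [hset, norm_event_sq_eq_sum T c (fun z : BitVec κ =>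
        {h : Cell N κ Y → BitVec κ | IsChainFrom (curry h) t (i + 1) z ys}) F]
      calc _ ≤ ∑ z ∈ T, (density T + 1 / l ^ 2) ^ k *
            ‖progress T l (S.erase c) (event {h | h c = z} F)‖ ^ 2 :=
            Finset.sum_le_sum fun z _ => ih (i + 1) z ys _ _ hS' (by simpa using hk)
        _ = (density T + 1 / l ^ 2) ^ k * ‖hit T c (progress T l (S.erase c) F)‖ ^ 2 := by
            rw [norm_hit_sq_eq_sum, Finset.mul_sum]
            simp only [hcomm]
        _ ≤ (density T + 1 / l ^ 2) ^ k *
              ((density T + 1 / l ^ 2) * ‖progress T l S F‖ ^ 2) := by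
            gcongr
            exact norm_hit_progress_sq_le hT (by linarith) (hS c le_rfl) F
        _ = _ := by ring
    · have hset : {h : Cell N κ Y → BitVec κ | IsChainFrom (curry h) t i x (y :: ys)} = ∅ := by
        ext h
        simp [IsChainFrom, hi]
      classical
      rw [hset, norm_event_sq]
      simp only [Set.mem_empty_iff_false, if_false, Finset.sum_const_zero]
      positivity

variable (A : Adversary N κ Y W)

/-- The joint state right before query number `n + 1`, with the oracles in uniform superposition
(not normalised). -/
def jointState (n : ℕ) : Joint N κ Y W :=
  WithLp.toLp 2 fun h => A.stateAfter (curry h) n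

theorem norm_progress_jointState_le (hT : density T < 1) (hl : 1 ≤ l) (n : ℕ) :
    ‖progress T l Finset.univ (jointState A n)‖ ≤
      Real.exp (l * √(density T)) ^ n * ‖jointState A 0‖ := by
  induction n with
  | zero =>
    rw [progress_apply_eq_self hT _ fun c h z => rfl]
    simp
  | succ n ih =>
    let U : Module.End ℂ (Joint N κ Y W) :=
      controlled fun _ => (A.unitary (n + 1)).toLinearEquiv.toLinearMap
    have hU : Commute (progress T l Finset.univ) U :=
      progress_commute fun c _ => known_commute_controlled fun _ _ => rfl
    have e : progress T l Finset.univ (jointState A (n + 1)) =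
        U (progress T l Finset.univ (jointQuery N κ Y W (jointState A n))) :=
      congrArg (fun f : Module.End ℂ (Joint N κ Y W) => f (jointQuery N κ Y W (jointState A n)))
        hU.eq
    rw [e, norm_controlled_eq fun _ v => LinearIsometryEquiv.norm_map _ v, pow_succ', mul_assoc]
    exact (norm_progress_jointQuery_le hT hl _).trans
      (mul_le_mul_of_nonneg_left ih (Real.exp_pos _).le)

theorem norm_jointState_sq (n : ℕ) :
    ‖jointState A n‖ ^ 2 = Fintype.card (Cell N κ Y → BitVec κ) := by
  rw [PiLp.norm_sq_eq_of_L2]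
  simp [jointState, norm_stateAfter]

/-- Each measurement outcome fixes the output, so the chain bound applies to each; `progress`
commutes with the measurement, so the outcomes recombine by Pythagoras. -/
theorem sum_successProbGiven_le {t : ℕ} (hTt : ∀ z, z ∈ T ↔ z.toNat < t)
    (hT : density T < 1) (hl : 1 ≤ l) (x₀ : BitVec κ) (k : ℕ) :
    ∑ h : Cell N κ Y → BitVec κ, successProbGiven A t x₀ k (curry h) ≤
      (density T + 1 / l ^ 2) ^ k * ‖progress T l Finset.univ (jointState A A.queries)‖ ^ 2 := by
  classical
  set Ψ := jointState A A.queries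
  unfold successProbGiven
  rw [Finset.sum_comm, norm_sq_eq_sum_measured (id : Register N κ Y W → _), Finset.mul_sum]
  refine Finset.sum_le_sum fun b _ => ?_
  have hs : 0 ≤ density T + 1 / l ^ 2 := add_nonneg (density_nonneg T) (by positivity)
  by_cases hk : k ≤ (A.output b).length
  · rw [← progress_measured]
    refine le_trans (le_of_eq ?_) (norm_event_isChainFrom_sq_le hTt hT hl k 0 x₀ (A.output b)
      Finset.univ _ (fun c _ => Finset.mem_univ c) hk)
    rw [norm_event_sq]
    refine Finset.sum_congr rfl fun h _ => ?_
    simp only [IsSolution, hk, true_and, Set.mem_ofPred_eq, controlled_apply, id]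
    rw [norm_restrict_singleton_sq]
    rfl
  · simp only [IsSolution, hk, false_and, if_false, Finset.sum_const_zero]
    positivity

theorem successProb_le {t : ℕ} (hTt : ∀ z, z ∈ T ↔ z.toNat < t)
    (hT : density T < 1) (hl : 1 ≤ l) (x₀ : BitVec κ) (k : ℕ) :
    successProb A t x₀ k ≤
      (density T + 1 / l ^ 2) ^ k * Real.exp (l * √(density T)) ^ (2 * A.queries) := by
  -- Stated for every instance because `successProb` uses one built from classical decidability.
  have hcard : ∀ inst : Fintype (Oracles N κ Y),
      (@Fintype.card (Oracles N κ Y) inst : ℝ) = Fintype.card (Cell N κ Y → BitVec κ) := fun inst =>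
    congrArg Nat.cast (Fintype.card_congr (Equiv.curry _ _ _).symm)
  have hsum : ∀ inst : Fintype (Oracles N κ Y),
      ∑ h ∈ @Finset.univ (Oracles N κ Y) inst, successProbGiven A t x₀ k h =
        ∑ h : Cell N κ Y → BitVec κ, successProbGiven A t x₀ k (curry h) := fun inst =>
    (Fintype.sum_equiv (Equiv.curry _ _ _) _ _ fun h => rfl).symm
  have hpos : (0 : ℝ) < Fintype.card (Cell N κ Y → BitVec κ) :=
    Nat.cast_pos.2 Fintype.card_pos
  have hs : 0 ≤ density T + 1 / l ^ 2 := add_nonneg (density_nonneg T) (by positivity)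
  unfold successProb
  rw [hsum, hcard, div_le_iff₀ hpos]
  refine (sum_successProbGiven_le A hTt hT hl x₀ k).trans ?_
  rw [mul_assoc]
  refine mul_le_mul_of_nonneg_left ?_ (pow_nonneg hs k)
  refine (pow_le_pow_left₀ (norm_nonneg _) (norm_progress_jointState_le A hT hl _) 2).trans
    (le_of_eq ?_)
  rw [mul_pow, norm_jointState_sq, ← pow_mul, mul_comm 2]

end Bound

end

/-! ### Target density and choice of the weight -/

theorem density_filter_toNat_lt {κ T : ℕ} (hT : T ≤ 2 ^ κ) :
    density (Finset.univ.filter fun z : BitVec κ => z.toNat < T) = (T : ℝ) / 2 ^ κ := by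
  have h1 : (Finset.univ.filter fun z : BitVec κ => z.toNat < T).card = T := by
    rw [← Finset.card_range T]
    refine Finset.card_bij (fun z _ => z.toNat) (fun z hz => by simpa using hz)
      (fun a _ b _ h => BitVec.eq_of_toNat_eq h) fun n hn => ?_
    have hn' : n < T := Finset.mem_range.1 hn
    have : (BitVec.ofNat κ n).toNat = n := by
      rw [BitVec.toNat_ofNat, Nat.mod_eq_of_lt (hn'.trans_le hT)]
    exact ⟨BitVec.ofNat κ n, by simp [this, hn'], this⟩
  have h2 : Fintype.card (BitVec κ) = 2 ^ κ := by
    rw [← FinEnum.card_eq_fintypeCard, FinEnum.card_bitVec]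
  rw [density, h1, h2]
  push_cast
  rfl

/-- With `l = k/(N√p)`, one has `p + 1/l² = p (k² + N²)/k²`, and `k² + N² ≤ (N + k)²`. -/
theorem bound_le_exp_log {p N k : ℝ} (hp : 0 < p) (hN : 0 < N) (n : ℕ) (hn : (n : ℝ) = k)
    (hk : 0 < k) :
    (p + 1 / (k / (N * √p)) ^ 2) ^ n * Real.exp (2 * k) ≤
      Real.exp (-2 * k * Real.log (k / (Real.exp 1 * (N + k)) * (1 / √p))) := by
  have hs : 0 < √p := Real.sqrt_pos.2 hp
  have hx : 0 < k / (Real.exp 1 * (N + k)) * (1 / √p) := by positivity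
  have e1 : Real.exp (-2 * k * Real.log (k / (Real.exp 1 * (N + k)) * (1 / √p))) =
      ((Real.exp 1 * (N + k) / k) ^ 2 * p) ^ n := by
    have : -2 * k * Real.log (k / (Real.exp 1 * (N + k)) * (1 / √p)) =
        n * (2 * -Real.log (k / (Real.exp 1 * (N + k)) * (1 / √p))) := by rw [hn]; ring
    rw [this, Real.exp_nat_mul, two_mul, Real.exp_add, Real.exp_neg, Real.exp_log hx, ← sq]
    congr 1
    nth_rewrite 2 [← Real.sq_sqrt hp.le]
    field_simp
  have e2 : Real.exp (2 * k) = (Real.exp 1 ^ 2) ^ n := by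
    rw [← Real.exp_nat_mul, ← Real.exp_nat_mul, hn]
    push_cast
    ring_nf
  rw [e1, e2, ← mul_pow]
  refine pow_le_pow_left₀ (by positivity) ?_ n
  have e3 : (p + 1 / (k / (N * √p)) ^ 2) = p * ((k ^ 2 + N ^ 2) / k ^ 2) := by
    rw [div_pow, mul_pow, Real.sq_sqrt hp.le]
    field_simp
  have e4 : (Real.exp 1 * (N + k) / k) ^ 2 * p =
      p * ((N + k) ^ 2 / k ^ 2) * Real.exp 1 ^ 2 := by
    rw [div_pow, mul_pow]
    ring
  rw [e3, e4]
  gcongr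
  nlinarith [mul_pos hN hk]

end ChainOfPoWs

open ChainOfPoWs in
theorem theorem2 {κ N k T : ℕ} (hT : 0 < T) (hTκ : T ≤ 2 ^ κ)
    {Y W : Type*} [Fintype Y] [Fintype W] (x₀ : BitVec κ)
    (A : ChainOfPoWs.Adversary N κ Y W) (hA : A.queries ≤ N)
    (p : ℝ) (hp : p = (T : ℝ) / 2 ^ κ) :
    ChainOfPoWs.successProb A T x₀ k ≤
      Real.exp (-2 * (k : ℝ) *
        Real.log ((k : ℝ) / (Real.exp 1 * ((N : ℝ) + (k : ℝ))) * (1 / Real.sqrt p))) := by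
  classical
  have hp0 : 0 < p := by rw [hp]; positivity
  have hs : 0 < √p := Real.sqrt_pos.2 hp0
  -- Here the claimed bound is at least `1`; this covers `k = 0`. Otherwise `(N + k)√p < k`, which
  -- yields both `p < 1` and `l ≥ 1`.
  by_cases hx : (k : ℝ) / (Real.exp 1 * ((N : ℝ) + (k : ℝ))) * (1 / √p) ≤ 1
  · refine (successProb_le_one A T x₀ k).trans (Real.one_le_exp ?_)
    have := Real.log_nonpos (by positivity) hx
    have hk : (0 : ℝ) ≤ k := by positivity
    nlinarith
  rcases Nat.eq_zero_or_pos k with rfl | hk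
  · simp at hx
  rcases Nat.eq_zero_or_pos N with rfl | hN
  -- For `N = 0` the query index register has no basis states, so the sum over outcomes is empty.
  · have : successProb A T x₀ k = 0 := by simp [successProb, successProbGiven]
    rw [this]
    exact (Real.exp_pos _).le
  have hk' : (0 : ℝ) < k := Nat.cast_pos.2 hk
  have hN' : (0 : ℝ) < N := Nat.cast_pos.2 hN
  have hlt : (N + k : ℝ) * √p < k := by
    rw [not_le, mul_one_div, div_div, one_lt_div (by positivity)] at hx
    have : (1 : ℝ) ≤ Real.exp 1 := Real.one_le_exp zero_le_one
    have h2 : 0 < (N + k : ℝ) * √p := by positivity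
    nlinarith
  have hsq : √p < 1 := by nlinarith
  have hdens := density_filter_toNat_lt hTκ
  rw [← hp] at hdens
  have hd : density (Finset.univ.filter fun z : BitVec κ => z.toNat < T) < 1 := by
    rw [hdens]
    simpa using (Real.sqrt_lt' one_pos).1 hsq
  -- This `l` minimises `l ^ (-2k) * exp (2Nl√p)`, making the exponent `2k`.
  have hl : (1 : ℝ) ≤ k / (N * √p) := by
    rw [le_div_iff₀ (by positivity)]
    nlinarith
  have h := successProb_le A (t := T) (fun z => by simp) hd hl x₀ k
  rw [hdens] at h
  refine h.trans (le_trans ?_ (bound_le_exp_log hp0 hN' k rfl hk'))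
  refine mul_le_mul_of_nonneg_left ?_ (by positivity)
  rw [← Real.exp_nat_mul]
  refine Real.exp_le_exp.2 ?_
  have e : (k : ℝ) / (N * √p) * √p = k / N := by field_simp
  rw [e]
  have hq : (A.queries : ℝ) ≤ N := Nat.cast_le.2 hA
  calc ((2 * A.queries : ℕ) : ℝ) * (k / N) = 2 * A.queries * (k / N) := by push_cast; ring
    _ ≤ 2 * N * (k / N) := by gcongr
    _ = 2 * k := by field_simp
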